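/- Let $K \subset \mathbb{R}^2$ be a symmetric convex body, that is, a compact convex set with nonempty interior such that $K = -K$, and suppose that $K$ has area $|K| = 1$. Let $N \ge 2$ be an integer, let $x_1, \dots, x_N$ be independent random points distributed uniformly in $K$, and put $$V_{K,N} = \frac{\mathrm{vol}_2\big(\mathrm{conv}\{\pm x_1, \dots, \pm x_N\}\big)}{\mathrm{vol}_2(K)}.$$ For $r \ge 0$ and $\theta \in \mathbb{R}$ let $$\ell(r,\theta) = \mathrm{vol}_1\big(\{(x,y) : (x,y)\cdot(\cos\theta,\sin\theta) = r\} \cap K\big), \qquad A(r,\theta) = \mathrm{vol}_2\big(\{(x,y) : |(x,y)\cdot(\cos\theta,\sin\theta)| \le r\} \cap K\big),$$ where $\mathrm{vol}_1$ is length and $\mathrm{vol}_2$ is area. Then $V_{K,N}$ is integrable, the function $(\theta,r) \mapsto A(r,\theta)^{N-1}\ell(r,\theta)^3$ is integrable on $(0,2\pi]\times(0,\infty)$, and $$\mathbb{E}\, V_{K,N} = 1 - \frac{N}{3} \int_0^{2\pi} \int_0^\infty A(r,\theta)^{N-1}\, \ell(r,\theta)^3 \, dr\, d\theta.$$ -/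

import Mathlib

noncomputable section

/-- Symmetric convex bodies: compact convex sets with interior points such that `K = -K`. -/
structure IsSymmConvexBody {n : ℕ} (K : Set (EuclideanSpace ℝ (Fin n))) : Prop where
  isCompact : IsCompact K
  convex : Convex ℝ K
  interior_nonempty : (interior K).Nonempty
  eq_neg : K = -K

/-- `vol_n (conv {± x₁, …, ± x_N}) / vol_n K`. -/
def symHullVolRatio {n N : ℕ} (K : Set (EuclideanSpace ℝ (Fin n)))
    (x : Fin N → EuclideanSpace ℝ (Fin n)) : ℝ :=
  (MeasureTheory.volume
      (convexHull ℝ (Set.range (fun i => x i) ∪ Set.range (fun i => -x i)))).toReal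
    / (MeasureTheory.volume K).toReal

/-- The unit vector `(cos θ, sin θ)`. -/
def dirVec (θ : ℝ) : EuclideanSpace ℝ (Fin 2) := !₂[Real.cos θ, Real.sin θ]

/-- The length of the chord `{x : x · (cos θ, sin θ) = r} ∩ K`. Length is the one-dimensional
Hausdorff measure, which on a line is the usual length with no further normalization. -/
def chordLength (K : Set (EuclideanSpace ℝ (Fin 2))) (r θ : ℝ) : ℝ :=
  (MeasureTheory.Measure.hausdorffMeasure 1
    ({x : EuclideanSpace ℝ (Fin 2) | inner ℝ x (dirVec θ) = r} ∩ K)).toReal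

/-- The area of the strip `{x : |x · (cos θ, sin θ)| ≤ r} ∩ K`. -/
def stripArea (K : Set (EuclideanSpace ℝ (Fin 2))) (r θ : ℝ) : ℝ :=
  (MeasureTheory.volume
    ({x : EuclideanSpace ℝ (Fin 2) | |inner ℝ x (dirVec θ)| ≤ r} ∩ K)).toReal

end

/-!
From a generic point `p` outside the symmetric polygon `conv {± x₁, …, ± x_N}`, exactly two of the
lines joining `p` to the points `± xₖ` are supporting lines of the polygon; from a point inside
there is none. Counting supporting lines thus turns twice the missed mass into a sum over the
`2 N` vertices, and, by independence, its expectation into the integral, over pairs of points of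
`K`, of the `(N - 1)`-st power of the mass of the symmetric strip bounded by the line through the
pair. Describing a pair by the line through it and two positions `s`, `t` on that line has
Jacobian `|s - t|` (Blaschke–Petkantschin), and integrating `|s - t|` over the pairs of points of
a chord of length `ℓ` gives `ℓ ^ 3 / 3`.
-/

open MeasureTheory ProbabilityTheory Set
open scoped ENNReal

/-! ### Supporting lines through a point -/

/-- The Euclidean plane. -/
abbrev Plane := EuclideanSpace ℝ (Fin 2)

/-- The determinant of the matrix with columns `x` and `y`. -/
def det2 (x y : Plane) : ℝ := x 0 * y 1 - x 1 * y 0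

theorem det2_self (x : Plane) : det2 x x = 0 := by
  rw [det2, mul_comm, sub_self]

theorem det2_zero_left (x : Plane) : det2 0 x = 0 := by
  simp only [det2, PiLp.zero_apply, zero_mul, sub_self]

theorem det2_neg_left (x y : Plane) : det2 (-x) y = -det2 x y := by
  simp only [det2, PiLp.neg_apply]
  ring

theorem det2_neg_right (x y : Plane) : det2 x (-y) = -det2 x y := by
  simp only [det2, PiLp.neg_apply]
  ring

theorem det2_swap (x y : Plane) : det2 x y = -det2 y x := by
  simp only [det2]
  ring

theorem isLinearMap_det2_left (w : Plane) : IsLinearMap ℝ fun z => det2 z w where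
  map_add z z' := by simp only [det2, PiLp.add_apply]; ring
  map_smul r z := by simp only [det2, PiLp.smul_apply, smul_eq_mul]; ring

theorem det2_sub_sub (p u v : Plane) : det2 (p - u) (p - v) = det2 p (u - v) + det2 u v := by
  simp only [det2, PiLp.sub_apply]
  ring

theorem exists_det2_eq_one {p : Plane} (hp : p ≠ 0) : ∃ q, det2 p q = 1 := by
  have hsq : p 0 ^ 2 + p 1 ^ 2 ≠ 0 := by
    rw [← Fin.sum_univ_two fun i : Fin 2 => p i ^ 2, ← EuclideanSpace.real_norm_sq_eq]
    exact pow_ne_zero 2 (norm_ne_zero_iff.mpr hp)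
  refine ⟨((p 0 ^ 2 + p 1 ^ 2)⁻¹ : ℝ) • !₂[-p 1, p 0], ?_⟩
  simp only [det2, PiLp.smul_apply, Matrix.cons_val_zero, Matrix.cons_val_one,
    smul_eq_mul]
  field_simp
  ring

theorem eq_det2_smul_add_det2_smul {p q : Plane} (hpq : det2 p q = 1) (z : Plane) :
    z = det2 z q • p + det2 p z • q := by
  ext i
  fin_cases i <;>
    simp only [det2, PiLp.add_apply, PiLp.smul_apply, smul_eq_mul, Fin.zero_eta, Fin.mk_one]
      at hpq ⊢
  · linear_combination -z 0 * hpq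
  · linear_combination -z 1 * hpq

theorem isLinearMap_det2_add_mul_det2 (p q : Plane) (c : ℝ) :
    IsLinearMap ℝ fun z => det2 z q + c * det2 p z where
  map_add z w := by simp only [det2, PiLp.add_apply]; ring
  map_smul r z := by simp only [det2, PiLp.smul_apply, smul_eq_mul]; ring

@[fun_prop]
theorem continuous_det2 {α : Type*} [TopologicalSpace α] {f g : α → Plane}
    (hf : Continuous f) (hg : Continuous g) : Continuous fun a => det2 (f a) (g a) := by
  unfold det2
  fun_prop

/-- The strip centred at the origin one of whose boundary lines passes through `p` and `y`. -/
def lineStrip (p y : Plane) : Set Plane :=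
  {z | |det2 z (p - y)| ≤ |det2 p y|}

theorem neg_mem_lineStrip {p y z : Plane} : -z ∈ lineStrip p y ↔ z ∈ lineStrip p y := by
  simp only [lineStrip, mem_ofPred_eq, det2_neg_left, abs_neg]

theorem lineStrip_neg_left (p y : Plane) : lineStrip (-p) y = lineStrip p (-y) := by
  ext z
  rw [lineStrip, lineStrip, mem_ofPred_eq, mem_ofPred_eq, det2_neg_left, det2_neg_right,
    neg_sub_left, sub_neg_eq_add, det2_neg_right, abs_neg, add_comm]

theorem right_mem_lineStrip (p y : Plane) : y ∈ lineStrip p y := by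
  have hdet : det2 y (p - y) = -det2 p y := by
    simp only [det2, PiLp.sub_apply]
    ring
  rw [lineStrip, mem_ofPred_eq, hdet, abs_neg]

theorem isClosed_setOf_mem_lineStrip {α : Type*} [TopologicalSpace α] {f g h : α → Plane}
    (hf : Continuous f) (hg : Continuous g) (hh : Continuous h) :
    IsClosed {a | f a ∈ lineStrip (g a) (h a)} := by
  simp only [lineStrip, mem_ofPred_eq]
  exact isClosed_le (by fun_prop) (by fun_prop)

/-- If `det2 p q = 1`, then the lines through `p` that miss the origin are the lines
`{z | det2 z q + c * det2 p z = 1}` with `c : ℝ`. The pencil parameter of `y` is the `c` of the line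
through `y`; it is the junk value `0` if `y` lies on the line through `p` and the origin. -/
noncomputable def pencilParam (p q y : Plane) : ℝ := (1 - det2 y q) / det2 p y

theorem mem_lineStrip_iff_pencilParam {p q y z : Plane} (hpq : det2 p q = 1)
    (hy : det2 p y ≠ 0) :
    z ∈ lineStrip p y ↔ |det2 z q + pencilParam p q y * det2 p z| ≤ 1 := by
  have hfactor : det2 z (p - y) =
      -(det2 p y * (det2 z q + pencilParam p q y * det2 p z)) := by
    rw [pencilParam, mul_add, ← mul_assoc, mul_div_cancel₀ _ hy]
    simp only [det2, PiLp.sub_apply] at hpq ⊢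
    linear_combination (z 0 * y 1 - z 1 * y 0) * hpq
  rw [lineStrip, mem_ofPred_eq, hfactor, abs_neg, abs_mul,
    mul_le_iff_le_one_right (abs_pos.mpr hy)]

theorem pencilParam_ne_of_det2_sub_ne_zero {p q u v : Plane} (hpq : det2 p q = 1)
    (hu : det2 p u ≠ 0) (hv : det2 p v ≠ 0) (huv : det2 (p - u) (p - v) ≠ 0) :
    pencilParam p q u ≠ pencilParam p q v := by
  contrapose! huv
  rw [pencilParam, pencilParam, div_eq_div_iff hu hv] at huv
  have hdet : det2 (p - u) (p - v) =
      (1 - det2 v q) * det2 p u - (1 - det2 u q) * det2 p v := by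
    simp only [det2, PiLp.sub_apply] at hpq ⊢
    linear_combination (u 1 * v 0 - u 0 * v 1) * hpq
  rw [hdet, huv, sub_self]

theorem add_mul_det2_le_one_iff {p q y : Plane} (hy : det2 p y ≠ 0) (c : ℝ) :
    det2 y q + c * det2 p y ≤ 1 ↔
      (0 < det2 p y → c ≤ pencilParam p q y) ∧ (¬0 < det2 p y → pencilParam p q y ≤ c) := by
  rcases hy.lt_or_gt with hneg | hpos
  · simp only [hneg.not_gt, pencilParam, div_le_iff_of_neg hneg, le_sub_iff_add_le',
      not_false_iff, false_imp_iff, true_imp_iff, true_and]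
  · simp only [hpos, pencilParam, le_div_iff₀ hpos, le_sub_iff_add_le', not_true, false_imp_iff,
      true_imp_iff, and_true]

theorem add_mul_det2_lt_one_iff {p q y : Plane} (hy : det2 p y ≠ 0) (c : ℝ) :
    det2 y q + c * det2 p y < 1 ↔
      (0 < det2 p y → c < pencilParam p q y) ∧ (¬0 < det2 p y → pencilParam p q y < c) := by
  rcases hy.lt_or_gt with hneg | hpos
  · simp only [hneg.not_gt, pencilParam, div_lt_iff_of_neg hneg, lt_sub_iff_add_lt',
      not_false_iff, false_imp_iff, true_imp_iff, true_and]
  · simp only [hpos, pencilParam, lt_div_iff₀ hpos, lt_sub_iff_add_lt', not_true, false_imp_iff,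
      true_imp_iff, and_true]

/-! ### Counting supporting lines -/

section Between

variable {κ α : Type*} [Finite κ] [LinearOrder α] {s : κ → α} {U : Set κ}

theorem exists_strictly_between_of_between [DenselyOrdered α] [NoMinOrder α] [NoMaxOrder α]
    (hs : Function.Injective s) {k : κ}
    (hk : ∀ l, (l ∈ U → s k ≤ s l) ∧ (l ∉ U → s l ≤ s k)) :
    ∃ c, ∀ l, (l ∈ U → c < s l) ∧ (l ∉ U → s l < c) := by
  classical
  have : Nonempty α := ⟨s k⟩
  have hlt : ∀ a ∈ (toFinite (s '' Uᶜ)).toFinset, ∀ b ∈ (toFinite (s '' U)).toFinset, a < b := by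
    simp only [Finite.mem_toFinset, forall_mem_image]
    intro l hl u hu
    refine (((hk l).2 hl).trans ((hk u).1 hu)).lt_of_ne (hs.ne ?_)
    rintro rfl
    exact hl hu
  obtain ⟨c, hlower, hupper⟩ := Order.exists_between_finsets _ _ hlt
  simp only [Finite.mem_toFinset, forall_mem_image] at hlower hupper
  exact ⟨c, fun l => ⟨fun hl => hupper hl, fun hl => hlower hl⟩⟩

theorem ncard_between_eq_two (hs : Function.Injective s) (hU : U.Nonempty) (hUc : Uᶜ.Nonempty)
    {c : α} (hc : ∀ l, (l ∈ U → c < s l) ∧ (l ∉ U → s l < c)) :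
    {k | ∀ l, (l ∈ U → s k ≤ s l) ∧ (l ∉ U → s l ≤ s k)}.ncard = 2 := by
  obtain ⟨u, huU, hu⟩ := exists_min_image U s (toFinite U) hU
  obtain ⟨v, hvU, hv⟩ := exists_max_image Uᶜ s (toFinite Uᶜ) hUc
  have hvu : s v < s u := ((hc v).2 hvU).trans ((hc u).1 huU)
  refine ncard_eq_two.mpr ⟨u, v, fun h => hvU (h ▸ huU), ?_⟩
  ext k
  constructor
  · intro hk
    by_cases hkU : k ∈ U
    · exact Or.inl (hs (((hk u).1 huU).antisymm (hu k hkU)))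
    · exact Or.inr (hs ((hv k hkU).antisymm ((hk v).2 hvU)))
  · rintro (rfl | rfl) l
    · exact ⟨hu l, fun hl => (hv l hl).trans hvu.le⟩
    · exact ⟨fun hl => hvu.le.trans (hu l hl), hv l⟩

end Between

theorem notMem_convexHull_iff_exists_dual {E : Type*} [NormedAddCommGroup E] [NormedSpace ℝ E]
    {s : Set E} (hs : s.Finite) (h0 : 0 ∈ convexHull ℝ s) {p : E} :
    p ∉ convexHull ℝ s ↔ ∃ f : StrongDual ℝ E, f p = 1 ∧ ∀ z ∈ s, f z < 1 := by
  constructor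
  · intro hp
    obtain ⟨f, u, hfu, hup⟩ := geometric_hahn_banach_closed_point (convex_convexHull ℝ s)
      (hs.isCompact_convexHull ℝ).isClosed hp
    have hfp : 0 < f p := by simpa only [map_zero] using (hfu 0 h0).trans hup
    refine ⟨(f p)⁻¹ • f, inv_mul_cancel₀ hfp.ne', fun z hz => ?_⟩
    have hz : f z < f p := (hfu z (subset_convexHull ℝ s hz)).trans hup
    simpa only [smul_apply, smul_eq_mul, inv_mul_lt_one₀ hfp] using hz
  · rintro ⟨f, hfp, hfs⟩ hp
    have hlt : f p < 1 :=
      convexHull_min hfs (convex_halfSpace_lt f.toLinearMap.isLinear 1) hp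
    exact hlt.ne hfp

section SupportingLines

variable {κ : Type*} {p q : Plane} {y : κ → Plane}

/-- The points from which the line to `y k` is a supporting line of the polygon spanned by `y`,
provided that the family `y` is symmetric. -/
def tangentSet (y : κ → Plane) (k : κ) : Set Plane :=
  {p | ∀ l, y l ∈ lineStrip p (y k)}

theorem det2_ne_zero_of_symm (hsymm : ∀ k, ∃ l ≠ k, y l = -y k)
    (hgen : Pairwise fun k l => det2 (p - y k) (p - y l) ≠ 0) (k : κ) : det2 p (y k) ≠ 0 := by
  obtain ⟨l, hlk, hl⟩ := hsymm k
  intro h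
  refine hgen hlk ?_
  rw [hl]
  simp only [det2, PiLp.sub_apply, PiLp.neg_apply] at h ⊢
  linear_combination -2 * h

theorem exists_det2_eq_one_of_symm [Nonempty κ] (hsymm : ∀ k, ∃ l ≠ k, y l = -y k)
    (hgen : Pairwise fun k l => det2 (p - y k) (p - y l) ≠ 0) : ∃ q, det2 p q = 1 := by
  obtain ⟨k⟩ := ‹Nonempty κ›
  refine exists_det2_eq_one ?_
  rintro rfl
  exact det2_ne_zero_of_symm hsymm hgen k (det2_zero_left _)

theorem injective_pencilParam (hpq : det2 p q = 1) (hsymm : ∀ k, ∃ l ≠ k, y l = -y k)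
    (hgen : Pairwise fun k l => det2 (p - y k) (p - y l) ≠ 0) :
    Function.Injective fun k => pencilParam p q (y k) := by
  have hne := det2_ne_zero_of_symm hsymm hgen
  intro k l h
  by_contra hkl
  exact pencilParam_ne_of_det2_sub_ne_zero hpq (hne k) (hne l) (hgen hkl) h

theorem forall_abs_le_one_iff (hsymm : ∀ k, ∃ l, y l = -y k) {f : Plane → ℝ}
    (hf : ∀ z, f (-z) = -f z) : (∀ l, |f (y l)| ≤ 1) ↔ ∀ l, f (y l) ≤ 1 := by
  refine ⟨fun h l => (le_abs_self _).trans (h l), fun h l => abs_le'.mpr ⟨h l, ?_⟩⟩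
  obtain ⟨m, hm⟩ := hsymm l
  rw [← hf, ← hm]
  exact h m

theorem zero_mem_convexHull_range_of_symm [Nonempty κ] (hsymm : ∀ k, ∃ l, y l = -y k) :
    0 ∈ convexHull ℝ (range y) := by
  obtain ⟨k⟩ := ‹Nonempty κ›
  obtain ⟨l, hl⟩ := hsymm k
  have hmid := (convex_convexHull ℝ (range y)).midpoint_mem
    (subset_convexHull ℝ _ (mem_range_self k)) (subset_convexHull ℝ _ (mem_range_self l))
  rwa [hl, midpoint_self_neg] at hmid

theorem mem_tangentSet_iff (hpq : det2 p q = 1) (hsymm : ∀ k, ∃ l ≠ k, y l = -y k)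
    (hgen : Pairwise fun k l => det2 (p - y k) (p - y l) ≠ 0) (k : κ) :
    p ∈ tangentSet y k ↔
      ∀ l, (0 < det2 p (y l) → pencilParam p q (y k) ≤ pencilParam p q (y l)) ∧
        (¬0 < det2 p (y l) → pencilParam p q (y l) ≤ pencilParam p q (y k)) := by
  have hne := det2_ne_zero_of_symm hsymm hgen
  simp only [tangentSet, mem_ofPred_eq, mem_lineStrip_iff_pencilParam hpq (hne k),
    ← add_mul_det2_le_one_iff (hne _)]
  exact forall_abs_le_one_iff (f := fun z => det2 z q + pencilParam p q (y k) * det2 p z)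
    (fun k => (hsymm k).imp fun _ => And.right) (isLinearMap_det2_add_mul_det2 p q _).map_neg

theorem notMem_convexHull_range_iff [Finite κ] [Nonempty κ] (hpq : det2 p q = 1)
    (hsymm : ∀ k, ∃ l ≠ k, y l = -y k)
    (hgen : Pairwise fun k l => det2 (p - y k) (p - y l) ≠ 0) :
    p ∉ convexHull ℝ (range y) ↔
      ∃ c, ∀ l, (0 < det2 p (y l) → c < pencilParam p q (y l)) ∧
        (¬0 < det2 p (y l) → pencilParam p q (y l) < c) := by
  have hne := det2_ne_zero_of_symm hsymm hgen
  have h0 := zero_mem_convexHull_range_of_symm fun k => (hsymm k).imp fun _ => And.right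
  rw [notMem_convexHull_iff_exists_dual (finite_range y) h0]
  simp only [forall_mem_range, ← add_mul_det2_lt_one_iff (hne _)]
  constructor
  · rintro ⟨f, hfp, hf⟩
    refine ⟨f q, fun l => ?_⟩
    have := hf l
    rwa [eq_det2_smul_add_det2_smul hpq (y l), map_add, map_smul, map_smul, hfp, smul_eq_mul,
      mul_one, smul_eq_mul, mul_comm] at this
  · rintro ⟨c, hc⟩
    refine ⟨((isLinearMap_det2_add_mul_det2 p q c).mk' _).toContinuousLinearMap, ?_, hc⟩
    change det2 p q + c * det2 p p = 1
    rw [hpq, det2_self, mul_zero, add_zero]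

theorem ncard_setOf_mem_tangentSet_eq_two [Finite κ] [Nonempty κ]
    (hsymm : ∀ k, ∃ l ≠ k, y l = -y k)
    (hgen : Pairwise fun k l => det2 (p - y k) (p - y l) ≠ 0)
    (hp : p ∉ convexHull ℝ (range y)) : {k | p ∈ tangentSet y k}.ncard = 2 := by
  have hne := det2_ne_zero_of_symm hsymm hgen
  obtain ⟨q, hpq⟩ := exists_det2_eq_one_of_symm hsymm hgen
  obtain ⟨c, hc⟩ := (notMem_convexHull_range_iff hpq hsymm hgen).mp hp
  obtain ⟨k⟩ := ‹Nonempty κ›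
  obtain ⟨l, -, hl⟩ := hsymm k
  have hkl : det2 p (y l) = -det2 p (y k) := by rw [hl, det2_neg_right]
  have hU : {k | 0 < det2 p (y k)}.Nonempty ∧ {k | 0 < det2 p (y k)}ᶜ.Nonempty := by
    rcases (hne k).lt_or_gt with hk | hk
    · exact ⟨⟨l, by rwa [mem_ofPred_eq, hkl, neg_pos]⟩, ⟨k, hk.not_gt⟩⟩
    · exact ⟨⟨k, hk⟩, ⟨l, by rw [mem_compl_iff, mem_ofPred_eq, hkl, neg_pos]; exact hk.not_gt⟩⟩
  simpa only [mem_tangentSet_iff hpq hsymm hgen, mem_ofPred_eq] using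
    ncard_between_eq_two (injective_pencilParam hpq hsymm hgen) hU.1 hU.2 hc

theorem notMem_tangentSet_of_mem_convexHull [Finite κ] (hsymm : ∀ k, ∃ l ≠ k, y l = -y k)
    (hgen : Pairwise fun k l => det2 (p - y k) (p - y l) ≠ 0)
    (hp : p ∈ convexHull ℝ (range y)) (k : κ) : p ∉ tangentSet y k := by
  have : Nonempty κ := ⟨k⟩
  obtain ⟨q, hpq⟩ := exists_det2_eq_one_of_symm hsymm hgen
  contrapose! hp
  exact (notMem_convexHull_range_iff hpq hsymm hgen).mpr <|
    exists_strictly_between_of_between (U := {l | 0 < det2 p (y l)})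
      (injective_pencilParam hpq hsymm hgen) ((mem_tangentSet_iff hpq hsymm hgen k).mp hp)

theorem sum_indicator_tangentSet [Fintype κ] [Nonempty κ] (hsymm : ∀ k, ∃ l ≠ k, y l = -y k)
    (hgen : Pairwise fun k l => det2 (p - y k) (p - y l) ≠ 0) :
    ∑ k, (tangentSet y k).indicator (1 : Plane → ℝ≥0∞) p =
      (convexHull ℝ (range y))ᶜ.indicator 2 p := by
  by_cases hp : p ∈ convexHull ℝ (range y)
  · rw [indicator_of_notMem (notMem_compl_iff.mpr hp)]
    exact Finset.sum_eq_zero fun k _ =>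
      indicator_of_notMem (notMem_tangentSet_of_mem_convexHull hsymm hgen hp k) _
  · classical
    rw [indicator_of_mem (mem_compl hp), Pi.ofNat_apply, ← Nat.cast_ofNat,
      ← ncard_setOf_mem_tangentSet_eq_two hsymm hgen hp, ncard_eq_toFinset_card']
    simp only [indicator_apply, Pi.one_apply, Finset.sum_boole, toFinset_ofPred]

end SupportingLines

/-! ### General position -/

/-- Measures on the plane that give every line measure zero, so that independent points are almost
surely in general position. -/
def NullOnLines (μ : Measure Plane) : Prop :=
  ∀ w ≠ 0, ∀ c, μ {z | det2 z w = c} = 0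

section NullOnLines

variable {μ ν : Measure Plane}

theorem nullOnLines_volume : NullOnLines volume := by
  intro w hw c
  obtain ⟨q, hq⟩ := exists_det2_eq_one hw
  let L : Plane →ₗ[ℝ] ℝ := (isLinearMap_det2_left w).mk' _
  have hqw : L q = -1 := by rw [IsLinearMap.mk'_apply, det2_swap, hq]
  have hker : LinearMap.ker L ≠ ⊤ := fun h => by
    have hq0 : L q = 0 := LinearMap.mem_ker.mp (h ▸ Submodule.mem_top)
    linarith
  have hline : {z | det2 z w = c} = (fun z => c • q + z) ⁻¹' (LinearMap.ker L : Set Plane) := by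
    ext z
    rw [mem_preimage, SetLike.mem_coe, LinearMap.mem_ker, map_add, map_smul, hqw, smul_eq_mul,
      mul_neg_one, neg_add_eq_zero, eq_comm]
    rfl
  rw [hline, measure_preimage_add]
  exact Measure.addHaar_submodule volume _ hker

theorem NullOnLines.mono_ac (hν : NullOnLines ν) (hμν : μ ≪ ν) : NullOnLines μ :=
  fun w hw c => hμν (hν w hw c)

theorem NullOnLines.nullSingletonClass (hμ : NullOnLines μ) : NullSingletonClass μ where
  measure_singleton z := by
    obtain ⟨w, hw⟩ := exists_ne (0 : Plane)
    exact measure_mono_null (t := {z' | det2 z' w = det2 z w}) (singleton_subset_iff.mpr rfl)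
      (hμ w hw _)

theorem NullOnLines.ae_pairwise_det2_sub_ne_zero {κ : Type*} [Countable κ] (hμ : NullOnLines μ)
    {y : κ → Plane} (hy : Function.Injective y) :
    ∀ᵐ p ∂μ, Pairwise fun k l => det2 (p - y k) (p - y l) ≠ 0 := by
  simp only [Pairwise, ae_all_iff, det2_sub_sub, ne_eq, add_eq_zero_iff_eq_neg]
  exact fun k l hkl => measure_eq_zero_iff_ae_notMem.mp (hμ _ (sub_ne_zero.mpr (hy.ne hkl)) _)

end NullOnLines

section SignedPoints

variable {ι E : Type*}

/-- The family consisting of the points `x i` and their antipodes `-x i`. -/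
def signedPoints [Neg E] (x : ι → E) : ι ⊕ ι → E := Sum.elim x (-x)

theorem exists_signedPoints_eq_neg [InvolutiveNeg E] (x : ι → E) (k : ι ⊕ ι) :
    ∃ l ≠ k, signedPoints x l = -signedPoints x k := by
  rcases k with i | i
  · exact ⟨Sum.inr i, Sum.inr_ne_inl, rfl⟩
  · exact ⟨Sum.inl i, Sum.inl_ne_inr, (neg_neg _).symm⟩

theorem range_signedPoints [Neg E] (x : ι → E) :
    range (signedPoints x) = range (fun i => x i) ∪ range fun i => -x i :=
  Sum.elim_range _ _

theorem injective_signedPoints [AddCommGroup E] [IsAddTorsionFree E] {x : ι → E}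
    (h0 : ∀ i, x i ≠ 0)
    (hpair : Pairwise fun i j => x i ≠ x j ∧ x i ≠ -x j) :
    Function.Injective (signedPoints x) := by
  have hinj : Function.Injective x := fun i j h => by
    by_contra hij
    exact (hpair hij).1 h
  refine hinj.sumElim (neg_injective.comp hinj) fun i j h => ?_
  rcases eq_or_ne i j with rfl | hij
  · exact h0 i (self_eq_neg.mp h)
  · exact (hpair hij).2 h

theorem measurableSet_tangentSet_signedPoints (x : ι → Plane) (k : ι ⊕ ι) :
    MeasurableSet (tangentSet (signedPoints x) k) := by
  rw [tangentSet, ofPred_forall]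
  exact (isClosed_iInter fun l => isClosed_setOf_mem_lineStrip (by fun_prop) (by fun_prop)
    (by fun_prop)).measurableSet

theorem tangentSet_signedPoints_inl (x : ι → Plane) (i : ι) :
    tangentSet (signedPoints x) (Sum.inl i) = {p | ∀ j, x j ∈ lineStrip p (x i)} := by
  ext p
  simp only [tangentSet, signedPoints, Sum.forall, Sum.elim_inl, Sum.elim_inr, Pi.neg_apply,
    neg_mem_lineStrip, and_self]

theorem tangentSet_signedPoints_inr (x : ι → Plane) (i : ι) :
    tangentSet (signedPoints x) (Sum.inr i) = -tangentSet (signedPoints x) (Sum.inl i) := by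
  ext p
  simp only [tangentSet, signedPoints, mem_neg, mem_ofPred_eq, Sum.elim_inl, Sum.elim_inr,
    Pi.neg_apply, lineStrip_neg_left]

theorem measure_compl_convexHull_signedPoints [Fintype ι] [Nonempty ι] {μ : Measure Plane}
    [μ.IsNegInvariant] (hμ : NullOnLines μ) {x : ι → Plane}
    (hx : Function.Injective (signedPoints x)) :
    μ (convexHull ℝ (range (signedPoints x)))ᶜ =
      ∑ i, μ {p | ∀ j, x j ∈ lineStrip p (x i)} := by
  have hhull : MeasurableSet (convexHull ℝ (range (signedPoints x))) :=
    ((finite_range _).isCompact_convexHull ℝ).measurableSet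
  have htangent := measurableSet_tangentSet_signedPoints x
  have hcount : 2 * μ (convexHull ℝ (range (signedPoints x)))ᶜ =
      ∑ k, μ (tangentSet (signedPoints x) k) := by
    simp only [← lintegral_indicator_one (htangent _)]
    rw [← lintegral_indicator_const hhull.compl,
      ← lintegral_finsetSum _ fun k _ => measurable_one.indicator (htangent k)]
    refine lintegral_congr_ae ?_
    filter_upwards [hμ.ae_pairwise_det2_sub_ne_zero hx] with p hp
    exact (sum_indicator_tangentSet (exists_signedPoints_eq_neg x) hp).symm
  simp only [Fintype.sum_sum_type, tangentSet_signedPoints_inr, Measure.measure_neg,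
    tangentSet_signedPoints_inl, ← two_mul] at hcount
  exact (ENNReal.mul_right_inj two_ne_zero ENNReal.ofNat_ne_top).mp hcount

end SignedPoints

/-! ### The expected missed mass -/

section Independent

variable {α : Type*} [MeasurableSpace α]

theorem ae_pi_ne_comp [MeasurableEq α] {ι : Type*} [Fintype ι] {μ : ι → Measure α}
    [∀ i, IsProbabilityMeasure (μ i)] {i j : ι} [NullSingletonClass (μ i)] (hij : i ≠ j)
    {f : α → α} (hf : Measurable f) : ∀ᵐ x ∂Measure.pi μ, x i ≠ f (x j) := by
  have hmap : (Measure.pi μ).map (fun x => (x j, x i)) = (μ j).prod (μ i) := by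
    have hindep : IndepFun (fun x : ι → α => x j) (fun x => x i) (Measure.pi μ) :=
      (iIndepFun_pi (X := fun _ => id) fun _ => aemeasurable_id).indepFun hij.symm
    rw [hindep.map_prod_eq_prod_map_map (measurable_pi_apply j).aemeasurable
      (measurable_pi_apply i).aemeasurable,
      (measurePreserving_eval μ j).map_eq, (measurePreserving_eval μ i).map_eq]
  have hprod : ∀ᵐ a ∂(μ j).prod (μ i), a.2 ≠ f a.1 :=
    (Measure.ae_prod_iff_ae_ae (measurableSet_eq_fun measurable_snd
      (hf.comp measurable_fst)).compl).mpr (ae_of_all _ fun y => Measure.ae_ne _ (f y))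
  rw [← hmap] at hprod
  exact ae_of_ae_map (f := fun x : ι → α => (x j, x i)) (by fun_prop) hprod

theorem pi_setOf_forall_mem (μ : Measure α) [SigmaFinite μ] {S : α → Set α}
    (hS : MeasurableSet {a : α × α | a.2 ∈ S a.1}) (hself : ∀ y, y ∈ S y) {n : ℕ}
    (i : Fin (n + 1)) :
    (Measure.pi fun _ : Fin (n + 1) => μ) {x | ∀ j, x j ∈ S (x i)} = ∫⁻ y, μ (S y) ^ n ∂μ := by
  have hset : {x : Fin (n + 1) → α | ∀ j, x j ∈ S (x i)} =
      MeasurableEquiv.piFinSuccAbove (fun _ => α) i ⁻¹' {a | ∀ j, a.2 j ∈ S a.1} := by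
    ext x
    exact (Fin.forall_iff_succAbove i).trans (and_iff_right (hself _))
  have hmeas : MeasurableSet {a : α × (Fin n → α) | ∀ j, a.2 j ∈ S a.1} := by
    rw [ofPred_forall]
    refine .iInter fun j => ?_
    exact (show Measurable fun a : α × (Fin n → α) => (a.1, a.2 j) by fun_prop) hS
  have hpi (y : α) : Prod.mk y ⁻¹' {a : α × (Fin n → α) | ∀ j, a.2 j ∈ S a.1} =
      Set.pi univ fun _ => S y := by
    ext z
    exact (mem_univ_pi).symm
  rw [hset, (measurePreserving_piFinSuccAbove (fun _ => μ) i).measure_preimage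
    hmeas.nullMeasurableSet, Measure.prod_apply hmeas]
  simp only [hpi, Measure.pi_pi, Finset.prod_const, Finset.card_univ, Fintype.card_fin]

end Independent

section ExpectedMissedMass

variable {μ : Measure Plane} [IsProbabilityMeasure μ]

theorem NullOnLines.ae_injective_signedPoints {ι : Type*} [Fintype ι] (hμ : NullOnLines μ) :
    ∀ᵐ x ∂Measure.pi fun _ : ι => μ, Function.Injective (signedPoints x) := by
  have := hμ.nullSingletonClass
  have : IsAddTorsionFree Plane := .of_module_rat _
  have h0 : ∀ᵐ x ∂Measure.pi fun _ : ι => μ, ∀ i, x i ≠ 0 :=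
    ae_all_iff.mpr fun i => Measure.ae_eval_ne _ i 0
  have hpair : ∀ᵐ x ∂Measure.pi fun _ : ι => μ, Pairwise fun i j => x i ≠ x j ∧ x i ≠ -x j := by
    simp only [Pairwise, ae_all_iff]
    exact fun i j hij => (ae_pi_ne_comp hij measurable_id).and (ae_pi_ne_comp hij measurable_neg)
  filter_upwards [h0, hpair] with x using injective_signedPoints

theorem measurableSet_setOf_forall_mem_lineStrip {ι : Type*} [Countable ι] (i : ι) :
    MeasurableSet {a : (ι → Plane) × Plane | ∀ j, a.1 j ∈ lineStrip a.2 (a.1 i)} := by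
  rw [ofPred_forall]
  exact (isClosed_iInter fun j => isClosed_setOf_mem_lineStrip (by fun_prop) (by fun_prop)
    (by fun_prop)).measurableSet

theorem measurable_measure_setOf_forall_mem_lineStrip {ι : Type*} [Countable ι] (i : ι) :
    Measurable fun x : ι → Plane => μ {p | ∀ j, x j ∈ lineStrip p (x i)} :=
  measurable_measure_prodMk_left (measurableSet_setOf_forall_mem_lineStrip i)

theorem lintegral_measure_setOf_forall_mem_lineStrip {n : ℕ} (i : Fin (n + 1)) :
    ∫⁻ x, μ {p | ∀ j, x j ∈ lineStrip p (x i)} ∂Measure.pi (fun _ : Fin (n + 1) => μ) =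
      ∫⁻ p, ∫⁻ y, μ (lineStrip p y) ^ n ∂μ ∂μ := by
  have hmeas := measurableSet_setOf_forall_mem_lineStrip i
  refine (Measure.prod_apply hmeas).symm.trans ((Measure.prod_apply_symm hmeas).trans ?_)
  exact lintegral_congr fun p => pi_setOf_forall_mem μ
    (isClosed_setOf_mem_lineStrip (by fun_prop) (by fun_prop) (by fun_prop)).measurableSet
    (right_mem_lineStrip p) i

variable [μ.IsNegInvariant]

theorem NullOnLines.ae_measure_compl_convexHull_eq {ι : Type*} [Fintype ι] [Nonempty ι]
    (hμ : NullOnLines μ) :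
    (fun x => μ (convexHull ℝ (range (signedPoints x)))ᶜ) =ᵐ[Measure.pi fun _ : ι => μ]
      fun x => ∑ i, μ {p | ∀ j, x j ∈ lineStrip p (x i)} := by
  filter_upwards [hμ.ae_injective_signedPoints] with x hx
  exact measure_compl_convexHull_signedPoints hμ hx

theorem NullOnLines.aemeasurable_measure_compl_convexHull {ι : Type*} [Fintype ι] [Nonempty ι]
    (hμ : NullOnLines μ) :
    AEMeasurable (fun x => μ (convexHull ℝ (range (signedPoints x)))ᶜ)
      (Measure.pi fun _ : ι => μ) :=
  (Finset.measurable_fun_sum Finset.univ fun i _ =>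
    measurable_measure_setOf_forall_mem_lineStrip i).aemeasurable.congr
    hμ.ae_measure_compl_convexHull_eq.symm

theorem NullOnLines.lintegral_measure_compl_convexHull (hμ : NullOnLines μ) (n : ℕ) :
    ∫⁻ x, μ (convexHull ℝ (range (signedPoints x)))ᶜ ∂Measure.pi (fun _ : Fin (n + 1) => μ) =
      (n + 1 : ℕ) * ∫⁻ p, ∫⁻ y, μ (lineStrip p y) ^ n ∂μ ∂μ := by
  rw [lintegral_congr_ae hμ.ae_measure_compl_convexHull_eq,
    lintegral_finsetSum _ fun i _ => measurable_measure_setOf_forall_mem_lineStrip i]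
  simp only [lintegral_measure_setOf_forall_mem_lineStrip, Finset.sum_const, Finset.card_univ,
    Fintype.card_fin, nsmul_eq_mul]

end ExpectedMissedMass

/-! ### Integration along lines -/

section Frame

/-- The unit vector orthogonal to `dirVec θ`. -/
noncomputable def tanVec (θ : ℝ) : Plane := !₂[-Real.sin θ, Real.cos θ]

/-- The point with coordinates `a` in the orthonormal frame `dirVec θ`, `tanVec θ`. For fixed first
coordinate `r`, it runs by arc length through the line `{z | inner ℝ z (dirVec θ) = r}`. -/
noncomputable def framePoint (θ : ℝ) (a : ℝ × ℝ) : Plane :=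
  a.1 • dirVec θ + a.2 • tanVec θ

theorem framePoint_apply_zero (θ : ℝ) (a : ℝ × ℝ) :
    framePoint θ a 0 = a.1 * Real.cos θ - a.2 * Real.sin θ :=
  (congrArg (a.1 * Real.cos θ + ·) (mul_neg _ _)).trans (sub_eq_add_neg _ _).symm

theorem framePoint_apply_one (θ : ℝ) (a : ℝ × ℝ) :
    framePoint θ a 1 = a.1 * Real.sin θ + a.2 * Real.cos θ := rfl

theorem inner_dirVec (z : Plane) (θ : ℝ) :
    inner ℝ z (dirVec θ) = z 0 * Real.cos θ + z 1 * Real.sin θ := by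
  rw [PiLp.inner_apply, Fin.sum_univ_two]
  exact congrArg₂ (· + ·) (mul_comm _ _) (mul_comm _ _)

theorem inner_framePoint_dirVec (θ : ℝ) (a : ℝ × ℝ) :
    inner ℝ (framePoint θ a) (dirVec θ) = a.1 := by
  rw [inner_dirVec, framePoint_apply_zero, framePoint_apply_one]
  linear_combination a.1 * Real.sin_sq_add_cos_sq θ

theorem exists_framePoint_inner_eq (θ : ℝ) (z : Plane) :
    ∃ t, framePoint θ (inner ℝ z (dirVec θ), t) = z := by
  refine ⟨z 1 * Real.cos θ - z 0 * Real.sin θ, ?_⟩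
  ext i
  fin_cases i <;> simp only [Fin.zero_eta, Fin.mk_one, framePoint_apply_zero,
    framePoint_apply_one, inner_dirVec]
  · linear_combination z 0 * Real.sin_sq_add_cos_sq θ
  · linear_combination z 1 * Real.sin_sq_add_cos_sq θ

theorem framePoint_add_smul_tanVec (θ a s ρ : ℝ) :
    framePoint θ (a, s) + ρ • tanVec θ = framePoint θ (a, s + ρ) := by
  simp only [framePoint, add_smul, add_assoc]

theorem framePoint_neg_neg (θ a s : ℝ) : framePoint θ (-a, -s) = -framePoint θ (a, s) := by
  simp only [framePoint, neg_smul, neg_add]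

@[fun_prop]
theorem continuous_dirVec : Continuous dirVec := by
  refine (PiLp.continuous_toLp 2 _).comp (continuous_pi fun i => ?_)
  fin_cases i
  exacts [Real.continuous_cos, Real.continuous_sin]

@[fun_prop]
theorem continuous_tanVec : Continuous tanVec := by
  refine (PiLp.continuous_toLp 2 _).comp (continuous_pi fun i => ?_)
  fin_cases i
  exacts [Real.continuous_sin.neg, Real.continuous_cos]

@[fun_prop]
theorem continuous_framePoint {α : Type*} [TopologicalSpace α] {f : α → ℝ} {g : α → ℝ × ℝ}
    (hf : Continuous f) (hg : Continuous g) : Continuous fun x => framePoint (f x) (g x) := by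
  unfold framePoint
  fun_prop

theorem dist_framePoint_sq (θ : ℝ) (a b : ℝ × ℝ) :
    dist (framePoint θ a) (framePoint θ b) ^ 2 = (a.1 - b.1) ^ 2 + (a.2 - b.2) ^ 2 := by
  rw [dist_eq_norm, EuclideanSpace.real_norm_sq_eq, Fin.sum_univ_two, PiLp.sub_apply,
    PiLp.sub_apply, framePoint_apply_zero, framePoint_apply_zero, framePoint_apply_one,
    framePoint_apply_one]
  linear_combination ((a.1 - b.1) ^ 2 + (a.2 - b.2) ^ 2) * Real.sin_sq_add_cos_sq θ

theorem isometry_framePoint (θ r : ℝ) : Isometry fun t : ℝ => framePoint θ (r, t) := by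
  refine Isometry.of_dist_eq fun s t => ?_
  rw [← sq_eq_sq₀ dist_nonneg dist_nonneg, dist_framePoint_sq, Real.dist_eq, sq_abs, sub_self,
    zero_pow two_ne_zero, zero_add]

theorem measurePreserving_framePoint (θ : ℝ) : MeasurePreserving (framePoint θ) := by
  have hisom : Isometry fun z : Plane => framePoint θ (z 0, z 1) := by
    refine Isometry.of_dist_eq fun z w => ?_
    rw [← sq_eq_sq₀ dist_nonneg dist_nonneg, dist_framePoint_sq, dist_eq_norm z w,
      EuclideanSpace.real_norm_sq_eq, Fin.sum_univ_two, PiLp.sub_apply, PiLp.sub_apply]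
  let L : Plane →ₗᵢ[ℝ] Plane :=
    { toFun := fun z => framePoint θ (z 0, z 1)
      map_add' := fun z w => by simp only [framePoint, PiLp.add_apply, add_smul]; abel
      map_smul' := fun r z => by
        simp only [framePoint, PiLp.smul_apply, smul_eq_mul, mul_smul, smul_add, RingHom.id_apply]
      norm_map' := hisom.norm_map_of_map_zero (by simp [framePoint]) }
  exact (L.toLinearIsometryEquiv rfl).measurePreserving.comp
    ((EuclideanSpace.volume_preserving_symm_measurableEquiv_toLp (Fin 2)).symm.comp
      (volume_preserving_finTwoArrow ℝ).symm)

end Frame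

section LineCoordinates

theorem lintegral_eq_lintegral_smul_tanVec {f : Plane → ℝ≥0∞} (hf : Measurable f) :
    ∫⁻ w, f w = ∫⁻ θ in Ioo (-Real.pi) Real.pi, ∫⁻ ρ in Ioi (0 : ℝ),
      ENNReal.ofReal ρ * f (ρ • tanVec θ) := by
  have htan (q : ℝ × ℝ) : framePoint (Real.pi / 2) (polarCoord.symm q) = q.1 • tanVec q.2 := by
    ext i
    fin_cases i <;> simp [framePoint_apply_zero, framePoint_apply_one, tanVec]
  rw [← (measurePreserving_framePoint (Real.pi / 2)).lintegral_comp hf,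
    ← lintegral_comp_polarCoord_symm, polarCoord_target, Measure.volume_eq_prod,
    ← Measure.prod_restrict]
  simp only [htan, smul_eq_mul]
  exact lintegral_prod_symm _ (by fun_prop)

theorem lintegral_lintegral_framePoint {ν : Measure ℝ} [SFinite ν] {G : Plane × ℝ → ℝ≥0∞}
    (hG : Measurable G) (θ : ℝ) :
    ∫⁻ ρ, (∫⁻ p, G (p, ρ)) ∂ν = ∫⁻ a, ∫⁻ s, ∫⁻ ρ, G (framePoint θ (a, s), ρ) ∂ν := by
  have hint : Measurable fun p => ∫⁻ ρ, G (p, ρ) ∂ν := hG.lintegral_prod_right'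
  have hframe := measurePreserving_framePoint θ
  calc ∫⁻ ρ, (∫⁻ p, G (p, ρ)) ∂ν
      = ∫⁻ p, ∫⁻ ρ, G (p, ρ) ∂ν :=
        lintegral_lintegral_swap (f := fun ρ p => G (p, ρ)) (by fun_prop)
    _ = ∫⁻ a, ∫⁻ ρ, G (framePoint θ a, ρ) ∂ν := (hframe.lintegral_comp hint).symm
    _ = ∫⁻ a, ∫⁻ s, ∫⁻ ρ, G (framePoint θ (a, s), ρ) ∂ν :=
        lintegral_prod _ (hint.comp hframe.measurable).aemeasurable

/-- The affine Blaschke–Petkantschin formula: `ρ` is the Jacobian. -/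
theorem lintegral_lintegral_eq_lintegral_lines {F : Plane × Plane → ℝ≥0∞} (hF : Measurable F) :
    ∫⁻ p, ∫⁻ y, F (p, y) = ∫⁻ θ in Ioo (-Real.pi) Real.pi, ∫⁻ a : ℝ, ∫⁻ s : ℝ,
      ∫⁻ ρ in Ioi (0 : ℝ), ENNReal.ofReal ρ * F (framePoint θ (a, s), framePoint θ (a, s + ρ)) := by
  calc ∫⁻ p, ∫⁻ y, F (p, y)
      = ∫⁻ p, ∫⁻ w, F (p, p + w) :=
        lintegral_congr fun p => (lintegral_add_left_eq_self (fun y => F (p, y)) p).symm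
    _ = ∫⁻ w, ∫⁻ p, F (p, p + w) := lintegral_lintegral_swap (by fun_prop)
    _ = ∫⁻ θ in Ioo (-Real.pi) Real.pi, ∫⁻ ρ in Ioi (0 : ℝ),
          ENNReal.ofReal ρ * ∫⁻ p, F (p, p + ρ • tanVec θ) :=
        lintegral_eq_lintegral_smul_tanVec (Measurable.lintegral_prod_right' (ν := volume)
          (f := fun a : Plane × Plane => F (a.2, a.2 + a.1)) (by fun_prop))
    _ = ∫⁻ θ in Ioo (-Real.pi) Real.pi, ∫⁻ ρ in Ioi (0 : ℝ), ∫⁻ p,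
          ENNReal.ofReal ρ * F (p, p + ρ • tanVec θ) := by
        simp only [lintegral_const_mul' _ _ ENNReal.ofReal_ne_top]
    _ = _ := by
        refine lintegral_congr fun θ => ?_
        refine (lintegral_lintegral_framePoint (ν := volume.restrict (Ioi 0)) (G := fun a =>
          ENNReal.ofReal a.2 * F (a.1, a.1 + a.2 • tanVec θ)) (by fun_prop) θ).trans ?_
        simp only [framePoint_add_smul_tanVec]

end LineCoordinates

/-! ### Integration over pairs of points of a convex body -/

section Interval

theorem setLIntegral_Ioc_zero_ofReal {b : ℝ} (hb : 0 ≤ b) :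
    ∫⁻ ρ in Ioc 0 b, ENNReal.ofReal ρ = ENNReal.ofReal (b ^ 2 / 2) := by
  have hint : IntegrableOn (fun ρ : ℝ => ρ) (Ioc 0 b) := continuous_id.integrableOn_Ioc
  rw [← ofReal_integral_eq_lintegral_ofReal hint
    ((ae_restrict_mem measurableSet_Ioc).mono fun ρ hρ => hρ.1.le),
    ← intervalIntegral.integral_of_le hb, integral_id, zero_pow two_ne_zero, sub_zero]

theorem setLIntegral_Icc_ofReal_sub_sq {c d : ℝ} (hcd : c ≤ d) :
    ∫⁻ s in Icc c d, ENNReal.ofReal ((d - s) ^ 2 / 2) = ENNReal.ofReal ((d - c) ^ 3 / 6) := by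
  rw [← ofReal_integral_eq_lintegral_ofReal
    (Continuous.integrableOn_Icc (by fun_prop)) (ae_of_all _ fun s => by positivity),
    integral_Icc_eq_integral_Ioc, ← intervalIntegral.integral_of_le hcd,
    intervalIntegral.integral_comp_sub_left (fun x : ℝ => x ^ 2 / 2) d,
    intervalIntegral.integral_div, integral_pow]
  ring_nf

theorem lintegral_lintegral_mul_indicator_Icc {c d : ℝ} (hcd : c ≤ d) :
    ∫⁻ s, ∫⁻ ρ in Ioi (0 : ℝ), ENNReal.ofReal ρ *
      ((Icc c d).indicator 1 s * (Icc c d).indicator 1 (s + ρ)) =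
      ENNReal.ofReal ((d - c) ^ 3 / 6) := by
  rw [← setLIntegral_Icc_ofReal_sub_sq hcd, ← lintegral_indicator measurableSet_Icc]
  refine lintegral_congr fun s => ?_
  by_cases hs : s ∈ Icc c d
  · have hρ : ∀ ρ ∈ Ioi (0 : ℝ), ENNReal.ofReal ρ *
        ((Icc c d).indicator 1 s * (Icc c d).indicator 1 (s + ρ)) =
        (Ioc 0 (d - s)).indicator ENNReal.ofReal ρ := by
      intro ρ (hρ : 0 < ρ)
      have hmem : s + ρ ∈ Icc c d ↔ ρ ∈ Ioc 0 (d - s) :=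
        ⟨fun h => ⟨hρ, by linarith [h.2]⟩, fun h => ⟨by linarith [hs.1], by linarith [h.2]⟩⟩
      simp only [indicator_apply, hs, hmem, if_true, Pi.one_apply, mul_ite, mul_one,
        mul_zero]
    rw [setLIntegral_congr_fun measurableSet_Ioi hρ, setLIntegral_indicator measurableSet_Ioc,
      inter_eq_left.mpr Ioc_subset_Ioi_self, indicator_of_mem hs,
      setLIntegral_Ioc_zero_ofReal (sub_nonneg.mpr hs.2)]
  · simp only [indicator_of_notMem hs, zero_mul, mul_zero, lintegral_zero]

theorem lintegral_lintegral_mul_indicator {I : Set ℝ} (hI : IsCompact I) (hconv : Convex ℝ I) :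
    ∫⁻ s, ∫⁻ ρ in Ioi (0 : ℝ), ENNReal.ofReal ρ * (I.indicator 1 s * I.indicator 1 (s + ρ)) =
      ENNReal.ofReal ((volume I).toReal ^ 3 / 6) := by
  rcases I.eq_empty_or_nonempty with rfl | hne
  · simp only [indicator_empty, mul_zero, lintegral_zero, measure_empty,
      ENNReal.toReal_zero, zero_pow three_ne_zero, zero_div, ENNReal.ofReal_zero]
  · have hle : sInf I ≤ sSup I := Real.sInf_le_sSup I hI.bddBelow hI.bddAbove
    rw [eq_Icc_of_connected_compact ⟨hne, hconv.isPreconnected⟩ hI,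
      lintegral_lintegral_mul_indicator_Icc hle, Real.volume_Icc,
      ENNReal.toReal_ofReal (sub_nonneg.mpr hle)]

end Interval

section Chord

/-- The chord of `K` on the line `{z | inner ℝ z (dirVec θ) = r}`, parametrized by arc length. -/
def chordParam (K : Set Plane) (r θ : ℝ) : Set ℝ := (fun t => framePoint θ (r, t)) ⁻¹' K

theorem range_framePoint (r θ : ℝ) :
    range (fun t => framePoint θ (r, t)) = {z | inner ℝ z (dirVec θ) = r} := by
  ext z
  constructor
  · rintro ⟨t, rfl⟩
    exact inner_framePoint_dirVec θ (r, t)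
  · rintro rfl
    exact exists_framePoint_inner_eq θ z

theorem chordLength_eq (K : Set Plane) (r θ : ℝ) :
    chordLength K r θ = (volume (chordParam K r θ)).toReal := by
  rw [chordLength, inter_comm, ← range_framePoint, ← image_preimage_eq_inter_range,
    (isometry_framePoint θ r).hausdorffMeasure_image (Or.inl zero_le_one), hausdorffMeasure_real]
  rfl

theorem isCompact_chordParam {K : Set Plane} (hK : IsCompact K) (r θ : ℝ) :
    IsCompact (chordParam K r θ) :=
  (isometry_framePoint θ r).isClosedEmbedding.isCompact_preimage hK

theorem convex_chordParam {K : Set Plane} (hK : Convex ℝ K) (r θ : ℝ) :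
    Convex ℝ (chordParam K r θ) := by
  have hline := (hK.translate_preimage_right (r • dirVec θ)).linear_preimage
    (LinearMap.toSpanSingleton ℝ Plane (tanVec θ))
  exact hline

theorem measurable_chordLength {K : Set Plane} (hK : IsClosed K) :
    Measurable fun q : ℝ × ℝ => chordLength K q.2 q.1 := by
  simp only [chordLength_eq]
  have hgraph : IsClosed {a : (ℝ × ℝ) × ℝ | framePoint a.1.1 (a.1.2, a.2) ∈ K} :=
    hK.preimage (by fun_prop)
  exact (measurable_measure_prodMk_left hgraph.measurableSet).ennreal_toReal

theorem chordLength_neg {K : Set Plane} (hK : K = -K) (r θ : ℝ) :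
    chordLength K (-r) θ = chordLength K r θ := by
  have hneg : chordParam K (-r) θ = -chordParam K r θ := by
    ext t
    have hpoint := framePoint_neg_neg θ r (-t)
    rw [neg_neg] at hpoint
    rw [chordParam, mem_preimage, hpoint, ← mem_neg, ← hK]
    rfl
  rw [chordLength_eq, chordLength_eq, hneg, Measure.measure_neg]

theorem chordLength_abs {K : Set Plane} (hK : K = -K) (r θ : ℝ) :
    chordLength K |r| θ = chordLength K r θ := by
  rcases abs_choice r with h | h <;> rw [h]
  exact chordLength_neg hK r θ

end Chord

section Strip

theorem lineStrip_framePoint (θ a s : ℝ) {ρ : ℝ} (hρ : 0 < ρ) :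
    lineStrip (framePoint θ (a, s)) (framePoint θ (a, s + ρ)) =
      {z | |inner ℝ z (dirVec θ)| ≤ |a|} := by
  have hdiff (z : Plane) : det2 z (framePoint θ (a, s) - framePoint θ (a, s + ρ)) =
      -ρ * inner ℝ z (dirVec θ) := by
    simp only [det2, PiLp.sub_apply, framePoint_apply_zero, framePoint_apply_one, inner_dirVec]
    ring
  have hdet : det2 (framePoint θ (a, s)) (framePoint θ (a, s + ρ)) = ρ * a := by
    simp only [det2, framePoint_apply_zero, framePoint_apply_one]
    linear_combination ρ * a * Real.sin_sq_add_cos_sq θ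
  ext z
  rw [lineStrip, mem_ofPred_eq, hdiff, hdet, abs_mul, abs_mul, abs_neg, mem_ofPred_eq]
  exact mul_le_mul_iff_right₀ (abs_pos.mpr hρ.ne')

theorem measurable_measure_lineStrip (μ : Measure Plane) [SFinite μ] :
    Measurable fun a : Plane × Plane => μ (lineStrip a.1 a.2) :=
  measurable_measure_prodMk_left (s := {a : (Plane × Plane) × Plane | a.2 ∈ lineStrip a.1.1 a.1.2})
    (isClosed_setOf_mem_lineStrip (by fun_prop) (by fun_prop) (by fun_prop)).measurableSet

theorem measurable_stripArea {K : Set Plane} (hK : MeasurableSet K) :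
    Measurable fun q : ℝ × ℝ => stripArea K q.2 q.1 := by
  have hstrip : IsClosed {a : (ℝ × ℝ) × Plane | |inner ℝ a.2 (dirVec a.1.1)| ≤ a.1.2} :=
    isClosed_le (by fun_prop) (by fun_prop)
  exact (measurable_measure_prodMk_left
    (hstrip.measurableSet.inter (measurable_snd hK))).ennreal_toReal

end Strip

section Pairs

variable {K : Set Plane}

theorem setLIntegral_setLIntegral_eq_lintegral_indicator {α : Type*} [MeasurableSpace α]
    {μ : Measure α} {s : Set α} (hs : MeasurableSet s) (F : α × α → ℝ≥0∞) :
    ∫⁻ p in s, ∫⁻ y in s, F (p, y) ∂μ ∂μ =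
      ∫⁻ p, ∫⁻ y, s.indicator 1 p * s.indicator 1 y * F (p, y) ∂μ ∂μ := by
  simp only [← lintegral_indicator hs]
  refine lintegral_congr fun p => ?_
  by_cases hp : p ∈ s
  · simp only [indicator_of_mem hp, Pi.one_apply, one_mul]
    refine lintegral_congr fun y => ?_
    by_cases hy : y ∈ s <;> simp [hy]
  · simp only [indicator_of_notMem hp, zero_mul, lintegral_zero]

theorem setLIntegral_measure_lineStrip_pow (hK : IsCompact K) (hconv : Convex ℝ K)
    (μ : Measure Plane) [IsFiniteMeasure μ] (n : ℕ) :
    ∫⁻ p in K, ∫⁻ y in K, μ (lineStrip p y) ^ n =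
      ∫⁻ θ in Ioo (-Real.pi) Real.pi, ∫⁻ a,
        μ {z | |inner ℝ z (dirVec θ)| ≤ |a|} ^ n * ENNReal.ofReal (chordLength K a θ ^ 3 / 6) := by
  have hKm : MeasurableSet K := hK.measurableSet
  have hind : Measurable (K.indicator 1 : Plane → ℝ≥0∞) := measurable_one.indicator hKm
  have hF : Measurable fun a : Plane × Plane =>
      K.indicator 1 a.1 * K.indicator 1 a.2 * μ (lineStrip a.1 a.2) ^ n :=
    ((hind.comp measurable_fst).mul (hind.comp measurable_snd)).mul
      ((measurable_measure_lineStrip μ).pow_const n)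
  rw [setLIntegral_setLIntegral_eq_lintegral_indicator hKm fun a => μ (lineStrip a.1 a.2) ^ n,
    lintegral_lintegral_eq_lintegral_lines hF]
  refine lintegral_congr fun θ => lintegral_congr fun a => ?_
  rw [chordLength_eq, ← lintegral_lintegral_mul_indicator (isCompact_chordParam hK a θ)
    (convex_chordParam hconv a θ)]
  have hfinite : μ {z | |inner ℝ z (dirVec θ)| ≤ |a|} ^ n ≠ ∞ :=
    ENNReal.pow_ne_top (measure_ne_top μ _)
  simp only [← lintegral_const_mul' _ _ hfinite]
  refine lintegral_congr fun s => setLIntegral_congr_fun measurableSet_Ioi fun ρ hρ => ?_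
  rw [lineStrip_framePoint θ a s hρ, ← mul_assoc, mul_comm]
  rfl

theorem lintegral_comp_abs (g : ℝ → ℝ≥0∞) : ∫⁻ a, g |a| = 2 * ∫⁻ a in Ioi (0 : ℝ), g a := by
  have hpos : ∫⁻ a in Ioi (0 : ℝ), g |a| = ∫⁻ a in Ioi (0 : ℝ), g a :=
    setLIntegral_congr_fun measurableSet_Ioi fun a ha => by rw [abs_of_pos (mem_Ioi.mp ha)]
  have hneg : ∫⁻ a in Iio (0 : ℝ), g |a| = ∫⁻ a in Ioi (0 : ℝ), g |a| := by
    have h := (Measure.measurePreserving_neg (volume : Measure ℝ)).setLIntegral_comp_preimage_emb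
      (MeasurableEquiv.neg ℝ).measurableEmbedding (fun a => g |a|) (Ioi 0)
    simpa only [abs_neg, neg_preimage, neg_Ioi, neg_zero] using h
  rw [← lintegral_add_compl _ measurableSet_Ioi, compl_Ioi, setLIntegral_congr Iio_ae_eq_Iic.symm,
    hneg, hpos, two_mul]

theorem setLIntegral_Ioc_eq_of_periodic {T : ℝ} (hT : 0 < T) {h : ℝ → ℝ≥0∞}
    (hper : Function.Periodic h T) (a b : ℝ) :
    ∫⁻ θ in Ioc a (a + T), h θ = ∫⁻ θ in Ioc b (b + T), h θ := by
  have : Fact (0 < T) := ⟨hT⟩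
  have hlift (c : ℝ) := AddCircle.lintegral_preimage T c hper.lift
  simp only [hper.lift_coe] at hlift
  rw [hlift, hlift]

theorem setLIntegral_measure_lineStrip_pow_of_symm (hK : IsCompact K) (hconv : Convex ℝ K)
    (hsymm : K = -K) (μ : Measure Plane) [IsFiniteMeasure μ] (n : ℕ) :
    ∫⁻ p in K, ∫⁻ y in K, μ (lineStrip p y) ^ n =
      ∫⁻ θ in Ioc 0 (2 * Real.pi), ∫⁻ r in Ioi (0 : ℝ),
        μ {z | |inner ℝ z (dirVec θ)| ≤ r} ^ n * ENNReal.ofReal (chordLength K r θ ^ 3 / 3) := by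
  have hperiodic : Function.Periodic (fun θ => ∫⁻ r in Ioi (0 : ℝ),
      μ {z | |inner ℝ z (dirVec θ)| ≤ r} ^ n * ENNReal.ofReal (chordLength K r θ ^ 3 / 3))
      (2 * Real.pi) := fun θ => by
    simp only [chordLength, dirVec, Real.cos_add_two_pi, Real.sin_add_two_pi]
  have hshift := setLIntegral_Ioc_eq_of_periodic Real.two_pi_pos hperiodic (-Real.pi) 0
  rw [zero_add, two_mul, neg_add_cancel_left, ← two_mul] at hshift
  rw [setLIntegral_measure_lineStrip_pow hK hconv, ← hshift, setLIntegral_congr Ioo_ae_eq_Ioc]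
  refine lintegral_congr fun θ => ?_
  have hfold := lintegral_comp_abs fun r =>
    μ {z | |inner ℝ z (dirVec θ)| ≤ r} ^ n * ENNReal.ofReal (chordLength K r θ ^ 3 / 6)
  simp only [chordLength_abs hsymm] at hfold
  rw [hfold, ← lintegral_const_mul' _ _ ENNReal.ofNat_ne_top]
  refine lintegral_congr fun r => ?_
  rw [mul_left_comm]
  congr 1
  rw [← ENNReal.ofReal_ofNat 2, ← ENNReal.ofReal_mul zero_le_two]
  ring_nf

end Pairs

/-! ### Uniform points -/

section Uniform

theorem isNegInvariant_cond {E : Type*} [MeasurableSpace E] [InvolutiveNeg E] [MeasurableNeg E]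
    {μ : Measure E} [μ.IsNegInvariant] {s : Set E} (hs : MeasurableSet s) (hsymm : s = -s) :
    (μ[|s]).IsNegInvariant where
  neg_eq_self := by
    have hpre := (Measure.measurePreserving_neg μ).restrict_preimage hs
    rw [neg_preimage, ← hsymm] at hpre
    rw [Measure.neg, ProbabilityTheory.cond, Measure.map_smul, hpre.map_eq]

variable {K : Set Plane}

theorem nullOnLines_cond : NullOnLines volume[|K] :=
  nullOnLines_volume.mono_ac cond_absolutelyContinuous

theorem cond_setOf_abs_inner_le (hK : volume K ≠ ∞) (r θ : ℝ) :
    volume[|K] {z | |inner ℝ z (dirVec θ)| ≤ r} =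
      (volume K)⁻¹ * ENNReal.ofReal (stripArea K r θ) := by
  have hstrip : MeasurableSet {z : Plane | |inner ℝ z (dirVec θ)| ≤ r} :=
    (isClosed_le (by fun_prop) continuous_const).measurableSet
  rw [ProbabilityTheory.cond, Measure.smul_apply, Measure.restrict_apply hstrip, stripArea,
    ENNReal.ofReal_toReal (measure_ne_top_of_subset inter_subset_right hK), smul_eq_mul]

theorem measurable_stripArea_pow_mul_chordLength_pow (hK : IsClosed K) (m n : ℕ) :
    Measurable fun q : ℝ × ℝ => stripArea K q.2 q.1 ^ m * chordLength K q.2 q.1 ^ n :=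
  ((measurable_stripArea hK.measurableSet).pow_const m).mul
    ((measurable_chordLength hK).pow_const n)

theorem stripArea_pow_mul_chordLength_pow_nonneg (r θ : ℝ) (m n : ℕ) :
    0 ≤ stripArea K r θ ^ m * chordLength K r θ ^ n :=
  mul_nonneg (pow_nonneg ENNReal.toReal_nonneg m) (pow_nonneg ENNReal.toReal_nonneg n)

end Uniform

section SymmConvexBody

section Dimension

variable {d : ℕ} {K : Set (EuclideanSpace ℝ (Fin d))}

theorem IsSymmConvexBody.volume_ne_zero (hK : IsSymmConvexBody K) : volume K ≠ 0 :=
  (Measure.measure_pos_of_nonempty_interior volume hK.interior_nonempty).ne'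

theorem IsSymmConvexBody.volume_ne_top (hK : IsSymmConvexBody K) : volume K ≠ ∞ :=
  hK.isCompact.measure_ne_top

theorem IsSymmConvexBody.isProbabilityMeasure_cond (hK : IsSymmConvexBody K) :
    IsProbabilityMeasure volume[|K] :=
  cond_isProbabilityMeasure_of_finite hK.volume_ne_zero hK.volume_ne_top

theorem IsSymmConvexBody.isNegInvariant_cond (hK : IsSymmConvexBody K) :
    (volume[|K]).IsNegInvariant :=
  _root_.isNegInvariant_cond (μ := volume) hK.isCompact.measurableSet hK.eq_neg

theorem IsSymmConvexBody.symHullVolRatio_eq {N : ℕ} (hK : IsSymmConvexBody K)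
    {x : Fin N → EuclideanSpace ℝ (Fin d)} (hx : ∀ i, x i ∈ K) :
    symHullVolRatio K x = 1 - (volume[|K] (convexHull ℝ (range (signedPoints x)))ᶜ).toReal := by
  have := hK.isProbabilityMeasure_cond
  have hsub : convexHull ℝ (range (signedPoints x)) ⊆ K := by
    refine convexHull_min ?_ hK.convex
    rintro z ⟨i | i, rfl⟩
    · exact hx i
    · rw [hK.eq_neg]
      exact neg_mem_neg.mpr (hx i)
  have hhull := ((finite_range (signedPoints x)).isCompact_convexHull ℝ).measurableSet
  have hcompl := probReal_compl_eq_one_sub (μ := volume[|K]) hhull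
  simp only [measureReal_def] at hcompl
  rw [hcompl, sub_sub_cancel, cond_apply' hhull, inter_eq_right.mpr hsub, ENNReal.toReal_mul,
    ENNReal.toReal_inv, inv_mul_eq_div, range_signedPoints, symHullVolRatio]

theorem IsSymmConvexBody.symHullVolRatio_ae_eq (hK : IsSymmConvexBody K) (N : ℕ) :
    symHullVolRatio K =ᵐ[Measure.pi fun _ : Fin N => volume[|K]]
      fun x => 1 - (volume[|K] (convexHull ℝ (range (signedPoints x)))ᶜ).toReal := by
  have := hK.isProbabilityMeasure_cond
  have hmem (i : Fin N) : ∀ᵐ x ∂Measure.pi fun _ : Fin N => volume[|K], x i ∈ K :=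
    (measurePreserving_eval (fun _ : Fin N => volume[|K]) i).quasiMeasurePreserving.ae
      (ae_cond_mem hK.isCompact.measurableSet)
  filter_upwards [ae_all_iff.mpr hmem] with x hx using hK.symHullVolRatio_eq hx

end Dimension

variable {K : Set Plane}

theorem IsSymmConvexBody.lintegral_cond_lineStrip_pow (hK : IsSymmConvexBody K) (n : ℕ) :
    ∫⁻ p, ∫⁻ y, volume[|K] (lineStrip p y) ^ n ∂volume[|K] ∂volume[|K] =
      (volume K)⁻¹ ^ (n + 2) * ENNReal.ofReal (1 / 3) *
        ∫⁻ q in Ioc 0 (2 * Real.pi) ×ˢ Ioi (0 : ℝ),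
          ENNReal.ofReal (stripArea K q.2 q.1 ^ n * chordLength K q.2 q.1 ^ 3) := by
  have := hK.isProbabilityMeasure_cond
  have hinv : (volume K)⁻¹ ≠ ∞ := ENNReal.inv_ne_top.mpr hK.volume_ne_zero
  have hcond (f : Plane → ℝ≥0∞) : ∫⁻ p, f p ∂volume[|K] = (volume K)⁻¹ * ∫⁻ p in K, f p :=
    lintegral_smul_measure _ _
  have hterm (r θ : ℝ) : ((volume K)⁻¹ * ENNReal.ofReal (stripArea K r θ)) ^ n *
      ENNReal.ofReal (chordLength K r θ ^ 3 / 3) = (volume K)⁻¹ ^ n * ENNReal.ofReal (1 / 3) *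
        ENNReal.ofReal (stripArea K r θ ^ n * chordLength K r θ ^ 3) := by
    have harea : 0 ≤ stripArea K r θ := ENNReal.toReal_nonneg
    have hlength : 0 ≤ chordLength K r θ := ENNReal.toReal_nonneg
    rw [div_eq_mul_one_div, ENNReal.ofReal_mul (pow_nonneg hlength 3),
      ENNReal.ofReal_mul (pow_nonneg harea n), ENNReal.ofReal_pow harea]
    ring
  have hmeas := (measurable_stripArea_pow_mul_chordLength_pow hK.isCompact.isClosed n
    3).ennreal_ofReal.aemeasurable (μ := volume.restrict (Ioc 0 (2 * Real.pi) ×ˢ Ioi (0 : ℝ)))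
  rw [Measure.volume_eq_prod, ← Measure.prod_restrict] at hmeas ⊢
  have hconst : (volume K)⁻¹ ^ n * ENNReal.ofReal (1 / 3) ≠ ∞ :=
    ENNReal.mul_ne_top (ENNReal.pow_ne_top hinv) ENNReal.ofReal_ne_top
  simp only [hcond, lintegral_const_mul' _ _ hinv]
  rw [setLIntegral_measure_lineStrip_pow_of_symm hK.isCompact hK.convex hK.eq_neg]
  simp only [cond_setOf_abs_inner_le hK.volume_ne_top, hterm, lintegral_const_mul' _ _ hconst]
  rw [lintegral_prod _ hmeas]
  ring

theorem IsSymmConvexBody.lintegral_cond_compl_convexHull (hK : IsSymmConvexBody K) (n : ℕ) :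
    ∫⁻ x, volume[|K] (convexHull ℝ (range (signedPoints x)))ᶜ
        ∂Measure.pi (fun _ : Fin (n + 1) => volume[|K]) =
      ENNReal.ofReal ((n + 1 : ℕ) / (3 * (volume K).toReal ^ (n + 2))) *
        ∫⁻ q in Ioc 0 (2 * Real.pi) ×ˢ Ioi (0 : ℝ),
          ENNReal.ofReal (stripArea K q.2 q.1 ^ n * chordLength K q.2 q.1 ^ 3) := by
  have := hK.isProbabilityMeasure_cond
  have := hK.isNegInvariant_cond
  have hpos : 0 < (volume K).toReal := ENNReal.toReal_pos hK.volume_ne_zero hK.volume_ne_top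
  have hconst : ENNReal.ofReal ((n + 1 : ℕ) / (3 * (volume K).toReal ^ (n + 2))) =
      (n + 1 : ℕ) * ((volume K)⁻¹ ^ (n + 2) * ENNReal.ofReal (1 / 3)) := by
    rw [div_eq_mul_inv, mul_inv, ← inv_pow, ← one_div, mul_comm (1 / 3 : ℝ),
      ENNReal.ofReal_mul (Nat.cast_nonneg _), ENNReal.ofReal_natCast,
      ENNReal.ofReal_mul (by positivity), ENNReal.ofReal_pow (by positivity),
      ENNReal.ofReal_inv_of_pos hpos, ENNReal.ofReal_toReal hK.volume_ne_top]
  rw [nullOnLines_cond.lintegral_measure_compl_convexHull, hK.lintegral_cond_lineStrip_pow, hconst]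
  simp only [mul_assoc]

theorem IsSymmConvexBody.integrable_cond_compl_convexHull (hK : IsSymmConvexBody K) (n : ℕ) :
    Integrable (fun x => (volume[|K] (convexHull ℝ (range (signedPoints x)))ᶜ).toReal)
      (Measure.pi fun _ : Fin (n + 1) => volume[|K]) := by
  have := hK.isProbabilityMeasure_cond
  have := hK.isNegInvariant_cond
  refine Integrable.of_bound
    nullOnLines_cond.aemeasurable_measure_compl_convexHull.ennreal_toReal.aestronglyMeasurable 1
    (ae_of_all _ fun x => ?_)
  rw [Real.norm_of_nonneg ENNReal.toReal_nonneg]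
  exact measureReal_le_one

theorem IsSymmConvexBody.integrable_symHullVolRatio (hK : IsSymmConvexBody K) (n : ℕ) :
    Integrable (symHullVolRatio K) (Measure.pi fun _ : Fin (n + 1) => volume[|K]) := by
  have := hK.isProbabilityMeasure_cond
  exact ((integrable_const 1).sub (hK.integrable_cond_compl_convexHull n)).congr
    (hK.symHullVolRatio_ae_eq (n + 1)).symm

theorem IsSymmConvexBody.integrableOn_stripArea_pow_mul_chordLength_pow (hK : IsSymmConvexBody K)
    (n : ℕ) : IntegrableOn (fun q : ℝ × ℝ => stripArea K q.2 q.1 ^ n * chordLength K q.2 q.1 ^ 3)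
      (Ioc 0 (2 * Real.pi) ×ˢ Ioi 0) := by
  have := hK.isProbabilityMeasure_cond
  have hpos : 0 < (volume K).toReal := ENNReal.toReal_pos hK.volume_ne_zero hK.volume_ne_top
  have hconst : ENNReal.ofReal ((n + 1 : ℕ) / (3 * (volume K).toReal ^ (n + 2))) ≠ 0 :=
    (ENNReal.ofReal_pos.mpr (by positivity)).ne'
  refine (lintegral_ofReal_ne_top_iff_integrable
    (measurable_stripArea_pow_mul_chordLength_pow hK.isCompact.isClosed n 3).aestronglyMeasurable
    (ae_of_all _ fun q => stripArea_pow_mul_chordLength_pow_nonneg q.2 q.1 n 3)).mp fun htop => ?_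
  have hmissed : ∫⁻ x, volume[|K] (convexHull ℝ (range (signedPoints x)))ᶜ
      ∂Measure.pi (fun _ : Fin (n + 1) => volume[|K]) ≤ 1 :=
    (lintegral_mono fun x => prob_le_one).trans_eq (by rw [lintegral_one, measure_univ])
  rw [hK.lintegral_cond_compl_convexHull n, htop, ENNReal.mul_top hconst] at hmissed
  exact ENNReal.one_lt_top.not_ge hmissed

theorem IsSymmConvexBody.integral_cond_compl_convexHull (hK : IsSymmConvexBody K) (n : ℕ) :
    ∫ x, (volume[|K] (convexHull ℝ (range (signedPoints x)))ᶜ).toReal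
        ∂Measure.pi (fun _ : Fin (n + 1) => volume[|K]) =
      (n + 1 : ℕ) / (3 * (volume K).toReal ^ (n + 2)) *
        ∫ q in Ioc 0 (2 * Real.pi) ×ˢ Ioi (0 : ℝ),
          stripArea K q.2 q.1 ^ n * chordLength K q.2 q.1 ^ 3 := by
  have := hK.isProbabilityMeasure_cond
  have := hK.isNegInvariant_cond
  have hconst : 0 ≤ ((n + 1 : ℕ) : ℝ) / (3 * (volume K).toReal ^ (n + 2)) := by positivity
  have hnonneg (q : ℝ × ℝ) : 0 ≤ stripArea K q.2 q.1 ^ n * chordLength K q.2 q.1 ^ 3 :=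
    stripArea_pow_mul_chordLength_pow_nonneg q.2 q.1 n 3
  have hmeas := measurable_stripArea_pow_mul_chordLength_pow hK.isCompact.isClosed n 3
  rw [integral_toReal nullOnLines_cond.aemeasurable_measure_compl_convexHull
      (ae_of_all _ fun x => measure_lt_top _ _),
    hK.lintegral_cond_compl_convexHull n, ENNReal.toReal_mul, ENNReal.toReal_ofReal hconst,
    integral_eq_lintegral_of_nonneg_ae (ae_of_all _ hnonneg) hmeas.aestronglyMeasurable]

theorem IsSymmConvexBody.integral_symHullVolRatio (hK : IsSymmConvexBody K) (n : ℕ) :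
    ∫ x, symHullVolRatio K x ∂Measure.pi (fun _ : Fin (n + 1) => volume[|K]) =
      1 - (n + 1 : ℕ) / (3 * (volume K).toReal ^ (n + 2)) *
        ∫ θ in (0 : ℝ)..(2 * Real.pi), ∫ r in Ioi (0 : ℝ),
          stripArea K r θ ^ n * chordLength K r θ ^ 3 := by
  have := hK.isProbabilityMeasure_cond
  have hfubini : ∫ q in Ioc 0 (2 * Real.pi) ×ˢ Ioi (0 : ℝ),
      stripArea K q.2 q.1 ^ n * chordLength K q.2 q.1 ^ 3 =
      ∫ θ in Ioc 0 (2 * Real.pi), ∫ r in Ioi (0 : ℝ),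
        stripArea K r θ ^ n * chordLength K r θ ^ 3 := by
    have hdouble := hK.integrableOn_stripArea_pow_mul_chordLength_pow n
    rw [Measure.volume_eq_prod] at hdouble ⊢
    exact setIntegral_prod _ hdouble
  rw [integral_congr_ae (hK.symHullVolRatio_ae_eq (n + 1)),
    integral_sub (integrable_const 1) (hK.integrable_cond_compl_convexHull n), integral_const,
    probReal_univ, one_smul, hK.integral_cond_compl_convexHull,
    intervalIntegral.integral_of_le Real.two_pi_pos.le, hfubini]

end SymmConvexBody

theorem mainTheorem4_general {K : Set Plane} (hK : IsSymmConvexBody K) {N : ℕ} (hN : N ≠ 0)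
    {Ω : Type*} [MeasurableSpace Ω] {P : Measure Ω} {X : Fin N → Ω → Plane}
    (hindep : iIndepFun X P) (hunif : ∀ i, pdf.IsUniform (X i) K P) :
    Integrable (fun ω => symHullVolRatio K (fun i => X i ω)) P ∧
    IntegrableOn (fun q : ℝ × ℝ => stripArea K q.2 q.1 ^ (N - 1) * chordLength K q.2 q.1 ^ 3)
      (Ioc 0 (2 * Real.pi) ×ˢ Ioi 0) ∧
    ∫ ω, symHullVolRatio K (fun i => X i ω) ∂P =
      1 - N / (3 * (volume K).toReal ^ (N + 1)) *
        ∫ θ in (0 : ℝ)..(2 * Real.pi), ∫ r in Ioi (0 : ℝ),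
          stripArea K r θ ^ (N - 1) * chordLength K r θ ^ 3 := by
  obtain ⟨n, rfl⟩ := Nat.exists_eq_add_one_of_ne_zero hN
  have hX (i : Fin (n + 1)) : AEMeasurable (X i) P :=
    (hunif i).aemeasurable hK.volume_ne_zero hK.volume_ne_top
  have hjoint : AEMeasurable (fun ω i => X i ω) P := aemeasurable_pi_lambda _ hX
  have hlaw : P.map (fun ω i => X i ω) = Measure.pi fun _ => volume[|K] :=
    (hindep.map_fun_eq_pi_map hX).trans (congrArg Measure.pi (funext hunif))
  have hint := hK.integrable_symHullVolRatio n
  rw [← hlaw] at hint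
  refine ⟨hint.comp_aemeasurable hjoint,
    hK.integrableOn_stripArea_pow_mul_chordLength_pow n, ?_⟩
  rw [← integral_map hjoint hint.aestronglyMeasurable, hlaw]
  exact hK.integral_symHullVolRatio n

theorem mainTheorem4 (K : Set (EuclideanSpace ℝ (Fin 2))) (hK : IsSymmConvexBody K)
    (hvol : MeasureTheory.volume K = 1) (N : ℕ) (hN : 2 ≤ N)
    {Ω : Type*} [MeasurableSpace Ω] (P : MeasureTheory.Measure Ω)
    [MeasureTheory.IsProbabilityMeasure P]
    (X : Fin N → Ω → EuclideanSpace ℝ (Fin 2)) (hX : ∀ i, Measurable (X i))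
    (hindep : ProbabilityTheory.iIndepFun X P)
    (hunif : ∀ i, MeasureTheory.pdf.IsUniform (X i) K P MeasureTheory.volume) :
    MeasureTheory.Integrable (fun ω => symHullVolRatio K (fun i => X i ω)) P ∧
    MeasureTheory.IntegrableOn
      (fun q : ℝ × ℝ => stripArea K q.2 q.1 ^ (N - 1) * chordLength K q.2 q.1 ^ 3)
      (Set.Ioc 0 (2 * Real.pi) ×ˢ Set.Ioi 0) MeasureTheory.volume ∧
    ∫ ω, symHullVolRatio K (fun i => X i ω) ∂P =
      1 - (N : ℝ) / 3 * ∫ θ in (0 : ℝ)..(2 * Real.pi), ∫ r in Set.Ioi (0 : ℝ),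
        stripArea K r θ ^ (N - 1) * chordLength K r θ ^ 3 := by
  simpa [hvol] using mainTheorem4_general hK (by lia) hindep hunif
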